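/- Let $K$ be a field, $n\ge 1$, $X=(x_{ij})$ the generic $n\times n$ matrix, $S=K[x_{ij}]$, $R=S/(\det X)$, and let $I_{n-1}(X)\subseteq S$ be the ideal generated by the $(n-1)\times(n-1)$ minors of $X$. Over $R$ put $L=\operatorname{cok}X$, $L^\vee=\operatorname{cok}X^T$, $M=\operatorname{cok}\operatorname{adj}(X)$ and $M^\vee=\operatorname{cok}\operatorname{adj}(X)^T$; multiplication by $X$ and by $X^T$ gives exact sequences $0\to M\to R^n\to L\to 0$ and $0\to M^\vee\to R^n\to L^\vee\to 0$. *Representing extensions by alternating matrices.* If $A$ is an alternating $n\times n$ matrix over $S$ ($A^T=-A$ with zero diagonal), there is a matrix $B$ with $A\operatorname{adj}(X)=X^TB$, so $A$ induces a homomorphism $M\to L^\vee$. We say that $A$ represents $\chi\in\operatorname{Ext}^1_R(L,L^\vee)$ if $\chi$ is the image of this homomorphism under the natural map $\operatorname{Hom}_R(M,L^\vee)\to\operatorname{Ext}^1_R(L,L^\vee)$ (push-out of $0\to M\to R^n\to L\to0$). Symmetrically, with $X^T$ in place of $X$, an alternating matrix $A'$ induces a homomorphism $M^\vee\to L$ and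 represents a class $\chi'\in\operatorname{Ext}^1_R(L^\vee,L)$. *Representing second extensions by elements of $S/I_{n-1}(X)$.* For square matrices $\varphi,\psi$ over $R$ with $\ker\varphi=\operatorname{im}\psi$ and $\ker\psi=\operatorname{im}\varphi$, let $\theta(\varphi,\psi)\in\operatorname{Ext}^2_R(\operatorname{cok}\varphi,\operatorname{cok}\varphi)$ be the class of $$0\to\operatorname{cok}\varphi\xrightarrow{\ \psi\ }R^n\xrightarrow{\ \varphi\ }R^n\to\operatorname{cok}\varphi\to0,$$ that is, the Yoneda product of the classes of $0\to\operatorname{cok}\psi\to R^n\to\operatorname{cok}\varphi\to0$ and $0\to\operatorname{cok}\varphi\to R^n\to\operatorname{cok}\psi\to0$. Put $\theta_L=\theta(X,\operatorname{adj}X)$. On $L^\vee$ use the dual of the periodic complex $X,\operatorname{adj}(X),X,\dots$: with the usual sign $d^\vee(f)=(-1)^{|f|}f\circ d$ its differentials are alternately $X^T$ and $-\operatorname{adj}(X)^T$, and we put $\theta_{L^\vee}=\theta(X^T,-\operatorname{adj}(X)^T)$. **Theorem.** Let $A=(a_{kl})$ and $A'=(a'_{kl})$ be alternating matrices over $S$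 representing $\chi\in\operatorname{Ext}^1_R(L,L^\vee)$ and $\chi'\in\operatorname{Ext}^1_R(L^\vee,L)$, and let $$r=-\sum_{k<l,\;u<v}(-1)^{u+v+k+l}\,a_{kl}\,[uv\;\widehat{\mid}\;kl]\,a'_{uv}\in S,$$ where $[uv\;\widehat{\mid}\;kl]$ is the determinant of the matrix obtained from $X$ by deleting rows $u,v$ and columns $k,l$. Then: 1. There is an $n\times n$ matrix $C$ over $S$ with $A\operatorname{adj}(X)A'=r\,X^T+X^TCX^T$. 2. The map $S\to\operatorname{Ext}^2_R(L,L)$, $s\mapsto s\,\theta_L$, induces a well-defined injective map on $S/I_{n-1}(X)$, which sends the image of $r$ to the Yoneda product $\chi'\chi$ (first $\chi$, then $\chi'$). 3. The map $S\to\operatorname{Ext}^2_R(L^\vee,L^\vee)$, $s\mapsto s\,\theta_{L^\vee}$, induces a well-defined injective map on $S/I_{n-1}(X)$, which sends the image of $r$ to $-\chi\chi'$. Moreover, with respect to the unsigned class, $r\cdot\theta(X^T,\operatorname{adj}(X)^T)=\chi\chi'$ in $\operatorname{Ext}^2_R(L^\vee,L^\vee)$. -/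

import Mathlib

open CategoryTheory CategoryTheory.Abelian

universe u

namespace DetExt

/-- The polynomial ring `S = K[x_ij]` in `n²` variables. -/
abbrev Poly (K : Type u) [Field K] (n : ℕ) : Type u := MvPolynomial (Fin n × Fin n) K

/-- The generic `n × n` matrix `X = (x_ij)` over `S`. -/
noncomputable abbrev genX (K : Type u) [Field K] (n : ℕ) :
    Matrix (Fin n) (Fin n) (Poly K n) := Matrix.mvPolynomialX (Fin n) (Fin n) K

/-- The hypersurface ring `R = S / (det X)`. -/
abbrev DetRing (K : Type u) [Field K] (n : ℕ) : Type u :=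
  Poly K n ⧸ Ideal.span {(genX K n).det}

/-- Reduction of a matrix over `S` modulo `det X`. -/
noncomputable def red {K : Type u} [Field K] {n : ℕ} (A : Matrix (Fin n) (Fin n) (Poly K n)) :
    Matrix (Fin n) (Fin n) (DetRing K n) :=
  A.map (Ideal.Quotient.mk (Ideal.span {(genX K n).det}))

/-- A square matrix is alternating if it is skew-symmetric with zero diagonal. -/
def IsAlternating {S : Type u} [CommRing S] {n : ℕ} (A : Matrix (Fin n) (Fin n) S) : Prop :=
  A.transpose = -A ∧ ∀ i, A i i = 0

/-- The ideal `I_t(Y)` generated by the `t × t` minors of `Y`. -/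
def minorsIdeal {S : Type u} [CommRing S] {n : ℕ} (t : ℕ) (Y : Matrix (Fin n) (Fin n) S) :
    Ideal S :=
  Ideal.span (Set.range fun p : (Fin t ↪o Fin n) × (Fin t ↪o Fin n) => (Y.submatrix p.1 p.2).det)

/-- The complementary minor `[s ^| t]` of `Y`: the determinant of the matrix obtained by removing
the rows in `s` and the columns in `t` (only used when `s` and `t` have the same size). -/
noncomputable def complMinor {S : Type u} [CommRing S] {n : ℕ} (Y : Matrix (Fin n) (Fin n) S)
    (s t : Finset (Fin n)) : S :=
  if h : tᶜ.card = sᶜ.card then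
    (Y.submatrix (sᶜ.orderEmbOfFin rfl) (tᶜ.orderEmbOfFin h)).det
  else 0

/-- The half-trace
`r = - ∑_{k<l, u<v} (-1)^(u+v+k+l) a_kl [uv ^| kl] a'_uv` for the generic matrix
(the sign is the same whether indices start at `0` or at `1`). -/
noncomputable def halfTrace {K : Type u} [Field K] {n : ℕ}
    (A A' : Matrix (Fin n) (Fin n) (Poly K n)) : Poly K n :=
  -∑ p ∈ (Finset.univ : Finset (Fin n × Fin n)).filter (fun p => p.1 < p.2),
    ∑ q ∈ (Finset.univ : Finset (Fin n × Fin n)).filter (fun q => q.1 < q.2),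
      (-1) ^ ((q.1 : ℕ) + (q.2 : ℕ) + (p.1 : ℕ) + (p.2 : ℕ)) *
        (A p.1 p.2 * complMinor (genX K n) {q.1, q.2} {p.1, p.2} * A' q.1 q.2)

section Cokernels

variable {R : Type u} [CommRing R] {n : ℕ}

/-- The cokernel of the square matrix `φ : Rⁿ → Rⁿ`. -/
noncomputable def cok (φ : Matrix (Fin n) (Fin n) R) : ModuleCat.{u} R :=
  ModuleCat.of R ((Fin n → R) ⧸ LinearMap.range φ.mulVecLin)

/-- `ker φ = im ψ` and `ker ψ = im φ`, so that `φ, ψ, φ, …` is a 2-periodic exact complex. -/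
structure PeriodicPair (φ ψ : Matrix (Fin n) (Fin n) R) : Prop where
  exact : Function.Exact ψ.mulVecLin φ.mulVecLin
  exact' : Function.Exact φ.mulVecLin ψ.mulVecLin

theorem PeriodicPair.symm {φ ψ : Matrix (Fin n) (Fin n) R} (h : PeriodicPair φ ψ) :
    PeriodicPair ψ φ := ⟨h.exact', h.exact⟩

theorem PeriodicPair.neg_right {φ ψ : Matrix (Fin n) (Fin n) R} (h : PeriodicPair φ ψ) :
    PeriodicPair φ (-ψ) := by
  constructor
  · intro v
    rw [h.exact v]
    constructor
    · rintro ⟨w, rfl⟩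
      exact ⟨-w, by simp [Matrix.mulVec_neg]⟩
    · rintro ⟨w, rfl⟩
      exact ⟨-w, by simp [Matrix.mulVec_neg]⟩
  · intro v
    rw [← h.exact' v]
    simp

/-- The sequence `0 → cok ψ → Rⁿ → cok φ → 0`, whose first map is induced by `φ`. -/
noncomputable def syzSeq {φ ψ : Matrix (Fin n) (Fin n) R} (h : PeriodicPair φ ψ) :
    ShortComplex (ModuleCat.{u} R) where
  X₁ := cok ψ
  X₂ := ModuleCat.of R (Fin n → R)
  X₃ := cok φ
  f := ModuleCat.ofHom <| (LinearMap.range ψ.mulVecLin).liftQ φ.mulVecLin <| by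
    rintro _ ⟨w, rfl⟩
    exact (h.exact _).2 ⟨w, rfl⟩
  g := ModuleCat.ofHom (LinearMap.range φ.mulVecLin).mkQ
  zero := by
    ext v
    induction v using Submodule.Quotient.induction_on with
    | H v => exact (Submodule.Quotient.mk_eq_zero _).2 ⟨v, rfl⟩

theorem syzSeq_shortExact {φ ψ : Matrix (Fin n) (Fin n) R} (h : PeriodicPair φ ψ) :
    (syzSeq h).ShortExact where
  exact := by
    rw [ShortComplex.moduleCat_exact_iff]
    intro v hv
    obtain ⟨w, hw⟩ := (Submodule.Quotient.mk_eq_zero _).1 hv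
    exact ⟨Submodule.Quotient.mk w, hw⟩
  mono_f := by
    rw [ModuleCat.mono_iff_injective]
    change Function.Injective ((LinearMap.range ψ.mulVecLin).liftQ φ.mulVecLin _)
    rw [← LinearMap.ker_eq_bot]
    refine Submodule.ker_liftQ_eq_bot _ _ _ ?_
    intro v hv
    exact (h.exact v).1 hv
  epi_g := by
    rw [ModuleCat.epi_iff_surjective]
    exact Submodule.mkQ_surjective _

/-- The class in `Ext¹(cok φ, cok ψ)` of `0 → cok ψ → Rⁿ → cok φ → 0`. -/
noncomputable def syzClass {φ ψ : Matrix (Fin n) (Fin n) R} (h : PeriodicPair φ ψ) :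
    Ext.{u} (cok φ) (cok ψ) 1 := (syzSeq_shortExact h).extClass

/-- The class in `Ext²(cok φ, cok φ)` of the 2-extension
`0 → cok φ → Rⁿ → Rⁿ → cok φ → 0` whose maps are induced by `ψ`, `φ` and the projection:
the image of the identity of `cok φ`, as second syzygy of itself in the 2-periodic resolution. -/
noncomputable def periodClass {φ ψ : Matrix (Fin n) (Fin n) R} (h : PeriodicPair φ ψ) :
    Ext.{u} (cok φ) (cok φ) 2 := (syzClass h).comp (syzClass h.symm) rfl

/-- The map `cok ψ → cok φ'` induced by `A`, for a commutative square `A ψ = φ' B`. It does not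
depend on `B`. -/
noncomputable def cokMap (ψ φ' A : Matrix (Fin n) (Fin n) R) (hB : ∃ B, A * ψ = φ' * B) :
    cok ψ ⟶ cok φ' :=
  ModuleCat.ofHom <| Submodule.mapQ _ _ A.mulVecLin <| by
    rintro _ ⟨w, rfl⟩
    obtain ⟨B, hB⟩ := hB
    exact ⟨B.mulVec w, by simp [Matrix.mulVec_mulVec, hB]⟩

end Cokernels

section Companion

variable {S : Type u} [CommRing S] {n : ℕ}

theorem exists_companion_vec (Y : Matrix (Fin n) (Fin n) S) (k l j : Fin n) :
    ∃ b : Fin n → S, Y.transpose.mulVec b =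
      Pi.single k (Y.adjugate l j) - Pi.single l (Y.adjugate k j) := by
  set Z := Y.updateRow j (Pi.single l 1) with hZ
  have hdet : Z.det = Y.adjugate l j := by rw [hZ, Matrix.adjugate_apply]
  have hkj : Z.adjugate k j = Y.adjugate k j := by
    rw [Matrix.adjugate_apply, Matrix.adjugate_apply, hZ, Matrix.updateRow_idem]
  refine ⟨fun r => if r = j then 0 else Z.adjugate k r, ?_⟩
  ext i
  have h := congrFun (congrFun (Matrix.adjugate_mul Z) k) i
  rw [Matrix.mul_apply, hdet] at h
  rw [← Finset.add_sum_erase _ _ (Finset.mem_univ j)] at h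
  have h1 : Z j i = (Pi.single l 1 : Fin n → S) i := by simp [hZ]
  have h2 : ∑ x ∈ Finset.univ.erase j, Z.adjugate k x * Z x i
      = ∑ x ∈ Finset.univ.erase j, Y x i * (if x = j then 0 else Z.adjugate k x) := by
    refine Finset.sum_congr rfl fun x hx => ?_
    have hx' : x ≠ j := Finset.ne_of_mem_erase hx
    rw [if_neg hx', hZ, Matrix.updateRow_ne hx', mul_comm]
  have h3 : Y.transpose.mulVec (fun r => if r = j then 0 else Z.adjugate k r) i
      = ∑ x ∈ Finset.univ.erase j, Y x i * (if x = j then 0 else Z.adjugate k x) := by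
    rw [Matrix.mulVec, dotProduct, ← Finset.add_sum_erase _ _ (Finset.mem_univ j)]
    simp
  rw [h3, ← h2]
  rw [h1, hkj] at h
  have h4 : (Y.adjugate l j • (1 : Matrix (Fin n) (Fin n) S)) k i
      = (Pi.single k (Y.adjugate l j) : Fin n → S) i := by
    simp [Matrix.one_apply, Pi.single_apply, eq_comm]
  have h5 : Y.adjugate k j * (Pi.single l 1 : Fin n → S) i
      = (Pi.single l (Y.adjugate k j) : Fin n → S) i := by
    simp [Pi.single_apply]
  rw [h4, h5] at h
  rw [Pi.sub_apply, ← h]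
  ring

/-- For `A` alternating, `A adj(Y) = Yᵀ B` for some matrix `B`. -/
theorem exists_companion (Y A : Matrix (Fin n) (Fin n) S) (hA : IsAlternating A) :
    ∃ B, A * Y.adjugate = Y.transpose * B := by
  have key : ∀ j, ∃ b : Fin n → S, Y.transpose.mulVec b = fun i => (A * Y.adjugate) i j := by
    intro j
    choose b hb using fun k l => exists_companion_vec Y k l j
    refine ⟨∑ p ∈ (Finset.univ : Finset (Fin n × Fin n)).filter (fun p => p.1 < p.2),
      A p.1 p.2 • b p.1 p.2, ?_⟩
    rw [← Matrix.mulVecLin_apply, map_sum]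
    simp only [map_smul, Matrix.mulVecLin_apply, hb]
    ext i
    have hskew : ∀ a c, A c a = -A a c := fun a c => congrFun (congrFun hA.1 a) c
    have e1 : (∑ p ∈ Finset.filter (fun p : Fin n × Fin n => p.1 < p.2) Finset.univ,
        A p.1 p.2 • ((Pi.single p.1 (Y.adjugate p.2 j) : Fin n → S)
          - (Pi.single p.2 (Y.adjugate p.1 j) : Fin n → S)) : Fin n → S) i
        = ∑ k, ∑ l, if k < l then A k l * ((if i = k then Y.adjugate l j else 0)
          - (if i = l then Y.adjugate k j else 0)) else 0 := by
      rw [Finset.sum_apply, Finset.sum_filter, Fintype.sum_prod_type]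
      simp [Pi.single_apply]
    rw [e1, Matrix.mul_apply]
    have e2 : ∀ k l : Fin n, (if k < l then A k l * ((if i = k then Y.adjugate l j else 0)
          - (if i = l then Y.adjugate k j else 0)) else 0)
        = (if i = k then (if k < l then A k l * Y.adjugate l j else 0) else 0)
          + (if i = l then (if k < l then A l k * Y.adjugate k j else 0) else 0) := by
      intro k l
      rw [hskew k l]
      split_ifs <;> ring
    simp only [e2, Finset.sum_add_distrib]
    have e3 : (∑ k, ∑ l, if i = k then (if k < l then A k l * Y.adjugate l j else 0) else 0)
        = ∑ l, if i < l then A i l * Y.adjugate l j else 0 := by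
      rw [Finset.sum_comm]
      simp
    have e4 : (∑ k, ∑ l, if i = l then (if k < l then A l k * Y.adjugate k j else 0) else 0)
        = ∑ k, if k < i then A i k * Y.adjugate k j else 0 := by
      simp
    rw [e3, e4, ← Finset.sum_add_distrib]
    refine Finset.sum_congr rfl fun l _ => ?_
    rcases lt_trichotomy i l with h | h | h
    · simp [h, h.not_gt]
    · subst h
      simp [hA.2 i]
    · simp [h, h.not_gt]
  choose b hb using key
  refine ⟨Matrix.of fun i j => b j i, ?_⟩
  ext i j
  rw [← congrFun (hb j) i]
  rfl

end Companion

section Generic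

variable (K : Type u) [Field K] (n : ℕ)

variable {K n} in
/-- If `det Y = det X`, then the matrix factorization `(Y, adj Y)` of `det X` reduces to a
2-periodic exact complex over `R`. -/
theorem periodicPair_red (Y : Matrix (Fin n) (Fin n) (Poly K n)) (hY : Y.det = (genX K n).det) :
    PeriodicPair (red Y) (red Y.adjugate) := by
  have hne : (genX K n).det ≠ 0 := Matrix.det_mvPolynomialX_ne_zero (Fin n) K
  have main : ∀ φ ψ : Matrix (Fin n) (Fin n) (Poly K n),
      φ * ψ = (genX K n).det • (1 : Matrix (Fin n) (Fin n) (Poly K n)) →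
      ψ * φ = (genX K n).det • (1 : Matrix (Fin n) (Fin n) (Poly K n)) →
      Function.Exact (red ψ).mulVecLin (red φ).mulVecLin := by
    intro φ ψ h1 h2 v
    have hmap : ∀ (A : Matrix (Fin n) (Fin n) (Poly K n)) (w : Fin n → Poly K n),
        (red A).mulVec (fun i => Ideal.Quotient.mk (Ideal.span {(genX K n).det}) (w i))
          = fun i => Ideal.Quotient.mk (Ideal.span {(genX K n).det}) (A.mulVec w i) := by
      intro A w
      ext i
      simp [red, Matrix.mulVec, dotProduct, map_sum]
    constructor
    · intro hv
      choose w hw using fun i => Ideal.Quotient.mk_surjective (v i)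
      have hv' : v = fun i => Ideal.Quotient.mk (Ideal.span {(genX K n).det}) (w i) :=
        funext fun i => (hw i).symm
      rw [Matrix.mulVecLin_apply, hv', hmap] at hv
      have hd : ∀ i, ∃ c, φ.mulVec w i = (genX K n).det * c := by
        intro i
        have := congrFun hv i
        rw [Pi.zero_apply, Ideal.Quotient.eq_zero_iff_mem, Ideal.mem_span_singleton] at this
        exact this
      choose c hc using hd
      refine ⟨fun i => Ideal.Quotient.mk _ (c i), ?_⟩
      rw [Matrix.mulVecLin_apply, hmap, hv']
      have hwc : ψ.mulVec c = w := by
        have e : φ.mulVec w = (genX K n).det • c := funext hc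
        have e2 : ψ.mulVec (φ.mulVec w) = (genX K n).det • w := by
          rw [Matrix.mulVec_mulVec, h2, Matrix.smul_mulVec, Matrix.one_mulVec]
        rw [e, Matrix.mulVec_smul] at e2
        exact smul_right_injective _ hne e2
      rw [hwc]
    · rintro ⟨w', rfl⟩
      choose w hw using fun i => Ideal.Quotient.mk_surjective (w' i)
      have hv' : w' = fun i => Ideal.Quotient.mk (Ideal.span {(genX K n).det}) (w i) :=
        funext fun i => (hw i).symm
      rw [Matrix.mulVecLin_apply, Matrix.mulVecLin_apply, hv', hmap, hmap,
        Matrix.mulVec_mulVec, h1]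
      ext i
      rw [Pi.zero_apply, Ideal.Quotient.eq_zero_iff_mem, Ideal.mem_span_singleton,
        Matrix.smul_mulVec, Matrix.one_mulVec]
      exact ⟨w i, rfl⟩
  have h1 : Y * Y.adjugate = (genX K n).det • (1 : Matrix (Fin n) (Fin n) (Poly K n)) := by
    rw [Matrix.mul_adjugate, hY]
  have h2 : Y.adjugate * Y = (genX K n).det • (1 : Matrix (Fin n) (Fin n) (Poly K n)) := by
    rw [Matrix.adjugate_mul, hY]
  exact ⟨main _ _ h1 h2, main _ _ h2 h1⟩

/-- `X` and `adj X` over `R`. -/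
theorem pairX : PeriodicPair (red (genX K n)) (red (genX K n).adjugate) :=
  periodicPair_red _ rfl

/-- `Xᵀ` and `adj(Xᵀ) = adj(X)ᵀ` over `R`. -/
theorem pairXT :
    PeriodicPair (red (genX K n).transpose) (red (genX K n).transpose.adjugate) :=
  periodicPair_red _ (Matrix.det_transpose _)

/-- `L = cok X`. -/
noncomputable def modL : ModuleCat.{u} (DetRing K n) := cok (red (genX K n))

/-- `L^∨ = cok Xᵀ`. -/
noncomputable def modLdual : ModuleCat.{u} (DetRing K n) := cok (red (genX K n).transpose)

/-- `M = cok adj(X)`, the first syzygy of `L`. -/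
noncomputable def modM : ModuleCat.{u} (DetRing K n) := cok (red (genX K n).adjugate)

/-- `M^∨ = cok adj(X)ᵀ`, the first syzygy of `L^∨`. -/
noncomputable def modMdual : ModuleCat.{u} (DetRing K n) :=
  cok (red (genX K n).transpose.adjugate)

/-- The class in `Ext²(L, L)` of the splice given by the resolution `… → Rⁿ → Rⁿ → L` of `L`
with differentials `X, adj(X), X, …`. -/
noncomputable def thetaL : Ext.{u} (modL K n) (modL K n) 2 := periodClass (pairX K n)

/-- The class in `Ext²(L^∨, L^∨)` of the splice given by the resolution of `L^∨`
with differentials `Xᵀ, adj(X)ᵀ, Xᵀ, …`. -/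
noncomputable def thetaLdual : Ext.{u} (modLdual K n) (modLdual K n) 2 :=
  periodClass (pairXT K n)

/-- The class in `Ext²(L^∨, L^∨)` of the splice given by the dual of the 2-periodic complex
`X, adj(X), X, …`, whose differentials are, with the usual sign `d^∨ f = (-1)^|f| f ∘ d` in the
complex `Hom_R(-, R)`, alternately `Xᵀ` and `-adj(X)ᵀ`. -/
noncomputable def thetaLdualSigned : Ext.{u} (modLdual K n) (modLdual K n) 2 :=
  periodClass (pairXT K n).neg_right

variable {K n}

theorem red_mul (A B : Matrix (Fin n) (Fin n) (Poly K n)) : red (A * B) = red A * red B :=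
  Matrix.map_mul

theorem exists_red {A ψ φ' : Matrix (Fin n) (Fin n) (Poly K n)} (h : ∃ B, A * ψ = φ' * B) :
    ∃ B, red A * red ψ = red φ' * B := by
  obtain ⟨B, hB⟩ := h
  exact ⟨red B, by rw [← red_mul, hB, red_mul]⟩

/-- The homomorphism `cok(A, B_A) : M → L^∨` given by an alternating matrix `A` and its
companion `B_A`, where `A adj(X) = Xᵀ B_A`. -/
noncomputable def altHom (A : Matrix (Fin n) (Fin n) (Poly K n)) (hA : IsAlternating A) :
    modM K n ⟶ modLdual K n :=
  cokMap _ _ (red A) (exists_red (exists_companion (genX K n) A hA))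

/-- The homomorphism `M^∨ → L` given by an alternating matrix `A'` and its companion `B'`,
where `A' adj(X)ᵀ = X B'`. -/
noncomputable def altHom' (A' : Matrix (Fin n) (Fin n) (Poly K n)) (hA' : IsAlternating A') :
    modMdual K n ⟶ modL K n :=
  cokMap _ _ (red A') (exists_red (exists_companion (genX K n).transpose A' hA'))

/-- The image of `cok(A, B_A)` under the natural map `Hom_R(M, L^∨) → Ext¹_R(L, L^∨)`:
the class of the push-out of `0 → M → Rⁿ → L → 0` along `cok(A, B_A)`. -/
noncomputable def extOfAlt (A : Matrix (Fin n) (Fin n) (Poly K n)) (hA : IsAlternating A) :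
    Ext.{u} (modL K n) (modLdual K n) 1 :=
  Ext.comp (Y := modM K n) (syzClass (pairX K n)) (Ext.mk₀ (altHom A hA)) (add_zero 1)

/-- The image of the map `M^∨ → L` given by `A'` under the natural map
`Hom_R(M^∨, L) → Ext¹_R(L^∨, L)`. -/
noncomputable def extOfAlt' (A' : Matrix (Fin n) (Fin n) (Poly K n)) (hA' : IsAlternating A') :
    Ext.{u} (modLdual K n) (modL K n) 1 :=
  Ext.comp (Y := modMdual K n) (syzClass (pairXT K n)) (Ext.mk₀ (altHom' A' hA')) (add_zero 1)

end Generic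

end DetExt

namespace DetExt

/-! ### Minors with two rows replaced by unit vectors, and the half-trace identity. -/

section TwoRowMinors

variable {S : Type u} [CommRing S] {n : ℕ}

/-! Everything reduces to matrix congruences modulo the image of $X$ or $X^T$.

Half-trace identity: both sides are bilinear in $A, A'$, so take $A=E_{kl}=e_ke_l^T-e_le_k^T$ and
$A'=E_{uv}$. The companion of $E_{kl}$ is explicit: $E_{kl}\operatorname{adj}(X)=X^TT$, where
$T_{ij}$ is the determinant of $X$ with rows $i,j$ replaced by $e_k,e_l$ (`elemAlt_mul_adjugate`).
Expanding determinants with a third row replaced gives $TE_{uv}\equiv -T_{uv}\cdot 1$ modulo right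
multiples of $X^T$ (`exists_twoRowMinor_mul_elemAlt`), and $T_{uv}$ is a signed complementary minor
(`twoRowMinor_eq_complMinor`).

Yoneda products: if $B$ is the companion of $A$, then $A$ and $B$ form a ladder of periodic
resolutions, so $\chi'\chi$ is $\theta_L$ followed by the endomorphism of $L$ induced by $A'B$
(`syzClass_comp_comp_syzClass_comp`). Cancelling $X^T$ in the half-trace identity and using that $B$
is skew-symmetric gives $A'B\equiv r\cdot 1$ modulo $X$. The other order is analogous.

Annihilator of $\theta$: by the long exact sequences, $s\theta=0$ exactly when $s\cdot\mathrm{id}$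
factors through the inclusion of the second syzygy into $R^n$, that is, when $H\psi=s\cdot 1+\varphi
C$ is solvable (`smul_periodClass_eq_zero_iff`). Always
$H\operatorname{adj}(X)\equiv\operatorname{tr}(H\operatorname{adj}(X))\cdot 1$ modulo $X$
(`exists_mul_adjugate_eq_trace`), and these traces fill out $I_{n-1}(X)$. Since the entries of
$\operatorname{adj}(X)$ have no common factor, $s$ is determined modulo $\det X\in I_{n-1}(X)$, so
no other $s$ occurs. -/

theorem det_eq_neg_of_swap_rows {M N : Matrix (Fin n) (Fin n) S} {i j : Fin n} (hij : i ≠ j)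
    (h : ∀ a, N a = M (Equiv.swap i j a)) : N.det = -M.det := by
  have : N = M.submatrix (Equiv.swap i j) id := by
    ext a b
    rw [h a]
    rfl
  rw [this, Matrix.det_permute, Equiv.Perm.sign_swap hij]
  simp

/-- For `i ≠ j`, the determinant of `Y` with row `i` replaced by `e_k` and row `j` by `e_l`. -/
noncomputable def twoRowMinor (Y : Matrix (Fin n) (Fin n) S) (k l : Fin n) :
    Matrix (Fin n) (Fin n) S :=
  -- On the diagonal the adjugate entry would be that of `Y` itself; it must be set to zero for the
  -- matrix to be alternating.
  Matrix.of fun i j => if i = j then 0 else (Y.updateRow j (Pi.single l 1)).adjugate k i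

theorem twoRowMinor_self (Y : Matrix (Fin n) (Fin n) S) (k l i : Fin n) :
    twoRowMinor Y k l i i = 0 := by
  simp [twoRowMinor]

theorem twoRowMinor_of_ne (Y : Matrix (Fin n) (Fin n) S) (k l : Fin n) {i j : Fin n}
    (h : i ≠ j) : twoRowMinor Y k l i j =
      ((Y.updateRow j (Pi.single l 1)).updateRow i (Pi.single k 1)).det := by
  simp [twoRowMinor, h, Matrix.adjugate_apply]

theorem twoRowMinor_swap (Y : Matrix (Fin n) (Fin n) S) (k l i j : Fin n) :
    twoRowMinor Y k l i j = -twoRowMinor Y k l j i := by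
  rcases eq_or_ne i j with rfl | h
  · simp [twoRowMinor_self]
  have swap_l : twoRowMinor Y k l i j = -((Y.updateRow i (Pi.single l 1)).updateRow j
      (Pi.single k 1)).det := by
    rw [twoRowMinor_of_ne _ _ _ h]
    refine det_eq_neg_of_swap_rows h fun a => ?_
    rcases eq_or_ne a i with rfl | hi
    · simp
    rcases eq_or_ne a j with rfl | hj
    · simp [h, h.symm]
    · rw [Equiv.swap_apply_of_ne_of_ne hi hj]
      simp [Matrix.updateRow_ne, hi, hj]
  rw [swap_l, twoRowMinor_of_ne _ _ _ h.symm]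

/-- Replace row `j` of `Y` by $e_l$ to get `Z` and read off row `k` of $\operatorname{adj}(Z)Z=\det
Z\cdot 1$. The summand from row `j` of `Z` is the term with $e_l$; the other summands involve only
rows of `Y`. -/
theorem transpose_mulVec_twoRowMinor (Y : Matrix (Fin n) (Fin n) S) (k l j : Fin n) :
    Y.transpose.mulVec (fun r => twoRowMinor Y k l r j) =
      Pi.single k (Y.adjugate l j) - Pi.single l (Y.adjugate k j) := by
  set Z := Y.updateRow j (Pi.single l 1) with hZ
  have hdet : Z.det = Y.adjugate l j := by rw [hZ, Matrix.adjugate_apply]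
  have hkj : Z.adjugate k j = Y.adjugate k j := by
    rw [Matrix.adjugate_apply, Matrix.adjugate_apply, hZ, Matrix.updateRow_idem]
  ext i
  have h := congrFun (congrFun (Matrix.adjugate_mul Z) k) i
  rw [Matrix.mul_apply, hdet, ← Finset.add_sum_erase _ _ (Finset.mem_univ j), hkj] at h
  have h1 : Z j i = (Pi.single l 1 : Fin n → S) i := by simp [hZ]
  have h2 : ∑ x ∈ Finset.univ.erase j, Z.adjugate k x * Z x i
      = Y.transpose.mulVec (fun r => twoRowMinor Y k l r j) i := by
    rw [Matrix.mulVec, dotProduct, ← Finset.add_sum_erase _ _ (Finset.mem_univ j),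
      twoRowMinor_self, mul_zero, zero_add]
    refine Finset.sum_congr rfl fun x hx => ?_
    have hx' : x ≠ j := Finset.ne_of_mem_erase hx
    simp [twoRowMinor, hx', hZ, mul_comm, Matrix.updateRow_ne]
  rw [h1, h2] at h
  rw [Pi.sub_apply, eq_sub_iff_add_eq']
  convert h using 1
  · simp [Pi.single_apply]
  · simp [Matrix.one_apply, Pi.single_apply, eq_comm]

/-- The elementary alternating matrix `e_k e_lᵀ - e_l e_kᵀ`. -/
def elemAlt (S : Type u) [CommRing S] (k l : Fin n) : Matrix (Fin n) (Fin n) S :=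
  Matrix.single k l 1 - Matrix.single l k 1

theorem elemAlt_mul_adjugate (Y : Matrix (Fin n) (Fin n) S) (k l : Fin n) :
    elemAlt S k l * Y.adjugate = Y.transpose * twoRowMinor Y k l := by
  ext i j
  have h := congrFun (transpose_mulVec_twoRowMinor Y k l j) i
  change _ = Y.transpose.mulVec (fun r => twoRowMinor Y k l r j) i
  rw [h]
  simp [elemAlt, Matrix.mul_apply, Matrix.single_apply, Pi.single_apply, ite_and,
    sub_mul, Finset.sum_sub_distrib, eq_comm (a := i)]

/-- Expansion of the minors of `Y` in which three rows are replaced by unit vectors. -/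
theorem exists_mulVec_eq_cyclic_sum (Y : Matrix (Fin n) (Fin n) S) (k l i u v : Fin n)
    (huv : u ≠ v) :
    ∃ c : Fin n → S, Y.mulVec c =
      Pi.single v (twoRowMinor Y k l i u) + Pi.single u (twoRowMinor Y k l v i) +
        Pi.single i (twoRowMinor Y k l u v) := by
  rcases eq_or_ne i u with rfl | hiu
  · refine ⟨0, ?_⟩
    rw [twoRowMinor_self, twoRowMinor_swap Y k l v i, add_assoc, ← Pi.single_add]
    simp
  rcases eq_or_ne i v with rfl | hiv
  · refine ⟨0, ?_⟩
    rw [twoRowMinor_self, twoRowMinor_swap Y k l i u, add_right_comm, ← Pi.single_add]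
    simp
  set W := (Y.updateRow u (Pi.single l 1)).updateRow i (Pi.single k 1) with hW
  -- The entry at `p` is the determinant of `Y` with rows `i`, `u`, `v` replaced by $e_k$, $e_l$,
  -- $e_p$. Hence entry `j` of `Y c` has row `Y j` in place of $e_p$: two rows agree unless `j` is
  -- `v`, `u` or `i`, and these three cases give the three terms.
  refine ⟨fun p => W.adjugate p v, ?_⟩
  have key : ∀ j, Y.mulVec (fun p => W.adjugate p v) j = (W.updateRow v (Y j)).det := by
    intro j
    rw [← Matrix.cramer_transpose_apply, Matrix.cramer_eq_adjugate_mulVec,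
      ← Matrix.adjugate_transpose]
    simp [Matrix.mulVec, dotProduct, mul_comm]
  ext j
  rw [key]
  rcases eq_or_ne j v with rfl | hjv
  · have : W.updateRow j (Y j) = W := by
      ext a b
      rcases eq_or_ne a j with rfl | ha
      · simp [hW, Matrix.updateRow_apply, hiv.symm, huv.symm]
      · simp [ha]
    rw [this]
    simp [huv.symm, hiv.symm, twoRowMinor_of_ne _ _ _ hiu, hW]
  rcases eq_or_ne j u with rfl | hju
  · have : (W.updateRow v (Y j)).det = -twoRowMinor Y k l i v := by
      rw [twoRowMinor_of_ne _ _ _ hiv]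
      refine det_eq_neg_of_swap_rows huv fun a => ?_
      rcases eq_or_ne a j with rfl | h1
      · simp [hW, hiu.symm, huv, hiv.symm]
      rcases eq_or_ne a v with rfl | h2
      · simp [hW, hiu.symm, huv]
      rw [Equiv.swap_apply_of_ne_of_ne h1 h2]
      simp [hW, Matrix.updateRow_apply, funext_iff, h1, h2]
    rw [this, ← twoRowMinor_swap]
    simp [huv, hiu.symm]
  rcases eq_or_ne j i with rfl | hji
  · have : (W.updateRow v (Y j)).det = -twoRowMinor Y k l v u := by
      rw [twoRowMinor_of_ne _ _ _ huv.symm]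
      refine det_eq_neg_of_swap_rows hiv fun a => ?_
      rcases eq_or_ne a j with rfl | h1
      · simp [hW, hiv]
      rcases eq_or_ne a v with rfl | h2
      · simp [hW, hiu, hiv]
      rw [Equiv.swap_apply_of_ne_of_ne h1 h2]
      simp [hW, h1, h2]
    rw [this, ← twoRowMinor_swap]
    simp [hiv, hiu]
  · rw [Matrix.det_zero_of_row_eq hjv]
    · simp [hjv, hju, hji]
    · ext b
      simp [hW, Matrix.updateRow_apply, hjv, hju, hji]

/-- Row `i` of the product is $T_{iu}e_v-T_{iv}e_u$, which is two of the three terms of the cyclic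
sum; the third, $T_{uv}e_i$, moves across with a minus sign. This is the origin of the sign in the
half-trace. -/
theorem exists_twoRowMinor_mul_elemAlt (Y : Matrix (Fin n) (Fin n) S) (k l : Fin n)
    {u v : Fin n} (huv : u ≠ v) :
    ∃ C, twoRowMinor Y k l * elemAlt S u v =
      (-twoRowMinor Y k l u v) • (1 : Matrix (Fin n) (Fin n) S) + C * Y.transpose := by
  choose c hc using fun i => exists_mulVec_eq_cyclic_sum Y k l i u v huv
  refine ⟨Matrix.of c, ?_⟩
  ext i j
  have h := congrFun (hc i) j
  have h1 : (Matrix.of c * Y.transpose) i j = Y.mulVec (c i) j := by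
    simp [Matrix.mul_apply, Matrix.mulVec, dotProduct, mul_comm]
  rw [Matrix.add_apply, h1, h, twoRowMinor_swap Y k l v i]
  have h2 : (twoRowMinor Y k l * elemAlt S u v) i j =
      (if v = j then twoRowMinor Y k l i u else 0) -
        (if u = j then twoRowMinor Y k l i v else 0) := by
    simp [elemAlt, Matrix.mul_apply, Matrix.single_apply, ite_and, mul_sub,
      Finset.sum_sub_distrib]
  simp only [h2, Pi.add_apply, Pi.single_apply, Matrix.smul_apply, Matrix.one_apply, smul_eq_mul,
    eq_comm (a := j)]
  split_ifs <;> ring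

theorem IsAlternating.eq_sum_elemAlt {A : Matrix (Fin n) (Fin n) S} (hA : IsAlternating A) :
    A = ∑ p ∈ (Finset.univ : Finset (Fin n × Fin n)).filter (fun p => p.1 < p.2),
      A p.1 p.2 • elemAlt S p.1 p.2 := by
  ext i j
  have hskew : ∀ a c, A c a = -A a c := fun a c => congrFun (congrFun hA.1 a) c
  rw [Matrix.sum_apply, Finset.sum_filter, Fintype.sum_prod_type]
  have e : ∀ k l : Fin n, (if k < l then (A k l • elemAlt S k l) i j else 0)
      = (if k = i then if l = j then (if k < l then A i j else 0) else 0 else 0)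
        + (if k = j then if l = i then (if k < l then A i j else 0) else 0 else 0) := by
    intro k l
    simp only [elemAlt, Matrix.smul_apply, Matrix.sub_apply, Matrix.single_apply, smul_eq_mul]
    by_cases hkl : k < l
    swap
    · simp [hkl]
    by_cases h1 : k = i
    · subst h1
      by_cases h2 : l = j
      · subst h2
        simp [hkl, hkl.ne, hkl.ne']
      · simp [hkl.ne', h2]
    · by_cases h3 : k = j
      · subst h3
        by_cases h4 : l = i
        · subst h4
          simp [hkl, hkl.ne', hskew k l]
        · simp [h1, h4]
      · simp [h1, h3]
  simp only [e, Finset.sum_add_distrib]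
  rw [Finset.sum_eq_single i (by simp +contextual) (by simp),
    Finset.sum_eq_single j (by simp +contextual) (by simp)]
  rcases lt_trichotomy i j with h | h | h
  · simp [h, h.not_gt]
  · subst h
    simp [hA.2 i]
  · simp [h, h.not_gt]

theorem exists_alternating_mul_adjugate_mul (Y : Matrix (Fin n) (Fin n) S)
    {A A' : Matrix (Fin n) (Fin n) S} (hA : IsAlternating A) (hA' : IsAlternating A') :
    ∃ C, A * Y.adjugate * A' =
      (-∑ p ∈ (Finset.univ : Finset (Fin n × Fin n)).filter (fun p => p.1 < p.2),
        ∑ q ∈ (Finset.univ : Finset (Fin n × Fin n)).filter (fun q => q.1 < q.2),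
          A p.1 p.2 * A' q.1 q.2 * twoRowMinor Y p.1 p.2 q.1 q.2) • Y.transpose +
        Y.transpose * C * Y.transpose := by
  choose c hc using fun (p : Fin n × Fin n) (q : {q : Fin n × Fin n // q.1 < q.2}) =>
    exists_twoRowMinor_mul_elemAlt Y p.1 p.2 q.2.ne
  have hc' : ∀ p q : Fin n × Fin n, q.1 < q.2 → ∃ C, twoRowMinor Y p.1 p.2 * elemAlt S q.1 q.2 =
      (-twoRowMinor Y p.1 p.2 q.1 q.2) • (1 : Matrix (Fin n) (Fin n) S) + C * Y.transpose :=
    fun p q h => ⟨_, hc p ⟨q, h⟩⟩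
  clear! c
  -- The choice is made total in `q` so that `c` can appear in a filtered sum; its values off `q.1 <
  -- q.2` do not matter.
  choose! c hc using hc'
  refine ⟨∑ p ∈ (Finset.univ : Finset (Fin n × Fin n)).filter (fun p => p.1 < p.2),
        ∑ q ∈ (Finset.univ : Finset (Fin n × Fin n)).filter (fun q => q.1 < q.2),
          (A p.1 p.2 * A' q.1 q.2) • c p q, ?_⟩
  conv_lhs => rw [hA.eq_sum_elemAlt, hA'.eq_sum_elemAlt]
  simp only [Finset.sum_mul, Finset.mul_sum, ← Finset.sum_neg_distrib, Finset.sum_smul,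
    ← Finset.sum_add_distrib]
  rw [Finset.sum_comm]
  refine Finset.sum_congr rfl fun p hp => Finset.sum_congr rfl fun q hq => ?_
  simp only [Matrix.smul_mul, Matrix.mul_smul, elemAlt_mul_adjugate, Matrix.mul_assoc,
    hc p q (Finset.mem_filter.1 hq).2, Matrix.mul_add, Matrix.mul_one, smul_add, smul_smul]
  congr 2 <;> ring

/-- Increasing maps are determined by their ranges, so the enumerations in `complMinor` may be
exchanged for composites of `succAbove`, which suit Laplace expansion. -/
theorem det_submatrix_eq_of_range_eq (Y : Matrix (Fin n) (Fin n) S) {c m : ℕ} (h : c = m)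
    (f g : Fin c ↪o Fin n) {f' g' : Fin m → Fin n} (hf' : StrictMono f') (hg' : StrictMono g')
    (hf : Set.range f = Set.range f') (hg : Set.range g = Set.range g') :
    (Y.submatrix f g).det = (Y.submatrix f' g').det := by
  subst h
  rw [(f.strictMono.range_inj hf').1 hf, (g.strictMono.range_inj hg').1 hg]

theorem exists_succAbove_of_lt {m : ℕ} {k l : Fin (m + 2)} (h : k < l) :
    ∃ l' : Fin (m + 1), k.succAbove l' = l ∧ (l : ℕ) = l' + 1 ∧
      Set.range (k.succAbove ∘ l'.succAbove) = {k, l}ᶜ := by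
  obtain ⟨l', rfl⟩ := Fin.exists_succAbove_eq h.ne'
  refine ⟨l', rfl, ?_, ?_⟩
  · rw [Fin.lt_succAbove_iff_le_castSucc] at h
    rw [Fin.succAbove_of_le_castSucc _ _ h]
    simp
  · rw [Set.range_comp, Fin.range_succAbove, Set.image_compl_eq_range_sdiff_image,
      Fin.range_succAbove]
    · ext; simp
    · exact Fin.succAbove_right_injective

/-- Laplace expansion along the two unit rows in turn. -/
theorem twoRowMinor_eq_complMinor (Y : Matrix (Fin n) (Fin n) S) {k l u v : Fin n}
    (hkl : k < l) (huv : u < v) :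
    twoRowMinor Y k l u v =
      (-1) ^ ((u : ℕ) + (v : ℕ) + (k : ℕ) + (l : ℕ)) * complMinor Y {u, v} {k, l} := by
  obtain ⟨m, rfl⟩ : ∃ m, n = m + 2 := ⟨n - 2, by have := l.2; have : (k : ℕ) < l := hkl; lia⟩
  have hcard : ∀ {a b : Fin (m + 2)}, a < b → ({a, b} : Finset (Fin (m + 2)))ᶜ.card = m := by
    intro a b h
    rw [Finset.card_compl, Finset.card_pair h.ne]
    simp
  obtain ⟨l', rfl, hl, hl'⟩ := exists_succAbove_of_lt hkl
  obtain ⟨v', rfl, hv, hv'⟩ := exists_succAbove_of_lt huv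
  rw [complMinor, dif_pos (by rw [hcard hkl, hcard huv])]
  rw [det_submatrix_eq_of_range_eq Y (hcard huv) _ _
    ((Fin.strictMono_succAbove u).comp (Fin.strictMono_succAbove v'))
    ((Fin.strictMono_succAbove k).comp (Fin.strictMono_succAbove l'))
    (by rw [hv', Finset.range_orderEmbOfFin, Finset.coe_compl,
      Finset.coe_pair])
    (by rw [hl', Finset.range_orderEmbOfFin, Finset.coe_compl,
      Finset.coe_pair])]
  rw [twoRowMinor, Matrix.of_apply, if_neg huv.ne, Matrix.adjugate_fin_succ_eq_det_submatrix]
  have e : (Y.updateRow (u.succAbove v') (Pi.single (k.succAbove l') 1)).submatrix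
      u.succAbove k.succAbove =
      (Y.submatrix u.succAbove k.succAbove).updateRow v' (Pi.single l' 1) := by
    ext a b
    simp [Matrix.updateRow_apply, Pi.single_apply]
  rw [e, ← Matrix.adjugate_apply, Matrix.adjugate_fin_succ_eq_det_submatrix, ← mul_assoc,
    ← pow_add, hl, hv, Matrix.submatrix_submatrix]
  congr 1
  -- After the first expansion the larger row and column indices each drop by one; the two shifts
  -- together leave the sign unchanged.
  rw [show (u : ℕ) + (v' + 1) + k + (l' + 1) = (u + k + (v' + l')) + 2 by ring, pow_add _ _ 2,
    neg_one_sq, mul_one, pow_add]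
end TwoRowMinors

/-! ### The adjugate ideal as the ideal of traces of multiples of the adjugate. -/

section AdjugateIdeal

variable {S : Type u} [CommRing S] {n : ℕ}

/-- The ideal generated by the entries of the adjugate of `Y`. -/
def adjugateIdeal (Y : Matrix (Fin n) (Fin n) S) : Ideal S :=
  Ideal.span (Set.range fun p : Fin n × Fin n => Y.adjugate p.1 p.2)

theorem adjugate_mem_adjugateIdeal (Y : Matrix (Fin n) (Fin n) S) (i j : Fin n) :
    Y.adjugate i j ∈ adjugateIdeal Y := Ideal.subset_span ⟨(i, j), rfl⟩

theorem adjugateIdeal_transpose (Y : Matrix (Fin n) (Fin n) S) :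
    adjugateIdeal Y.transpose = adjugateIdeal Y := by
  unfold adjugateIdeal
  congr 1
  ext x
  constructor <;> rintro ⟨⟨i, j⟩, rfl⟩ <;>
    exact ⟨(j, i), by simp [← Matrix.adjugate_transpose]⟩

theorem exists_orderEmb_eq_succAbove {m : ℕ} (f : Fin m ↪o Fin (m + 1)) :
    ∃ i : Fin (m + 1), ⇑f = i.succAbove := by
  obtain ⟨i, hi⟩ : ∃ i, i ∉ Set.range f := by
    by_contra! h
    have := Fintype.card_le_of_surjective f h
    simp at this
  refine ⟨i, (f.strictMono.range_inj (Fin.strictMono_succAbove i)).1 ?_⟩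
  rw [Fin.range_succAbove]
  refine Set.eq_of_subset_of_ncard_le (fun x hx hxi => hi (hxi ▸ hx)) ?_ (Set.toFinite _)
  rw [Set.ncard_compl, Set.ncard_range_of_injective f.injective]
  simp

theorem minorsIdeal_pred_eq_adjugateIdeal {m : ℕ} (Y : Matrix (Fin (m + 1)) (Fin (m + 1)) S) :
    minorsIdeal m Y = adjugateIdeal Y := by
  apply le_antisymm
  · rw [minorsIdeal, Ideal.span_le]
    rintro _ ⟨⟨f, g⟩, rfl⟩
    obtain ⟨i, hi⟩ := exists_orderEmb_eq_succAbove f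
    obtain ⟨j, hj⟩ := exists_orderEmb_eq_succAbove g
    have h : (Y.submatrix f g).det = (-1) ^ ((i : ℕ) + j) * Y.adjugate j i := by
      rw [Matrix.adjugate_fin_succ_eq_det_submatrix, ← mul_assoc, ← mul_pow, hi, hj]
      simp
    change (Y.submatrix f g).det ∈ adjugateIdeal Y
    rw [h]
    exact Ideal.mul_mem_left _ _ (adjugate_mem_adjugateIdeal Y j i)
  · rw [adjugateIdeal, Ideal.span_le]
    rintro _ ⟨⟨i, j⟩, rfl⟩
    change Y.adjugate i j ∈ minorsIdeal m Y
    rw [Matrix.adjugate_fin_succ_eq_det_submatrix]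
    exact Ideal.mul_mem_left _ _
      (Ideal.subset_span ⟨(Fin.succAboveOrderEmb j, Fin.succAboveOrderEmb i), rfl⟩)

/-- For a matrix unit $H=e_pe_i^T$, column `q` of $H\operatorname{adj}(Y)$ is
$\operatorname{adj}(Y)_{iq}e_p$. By `exists_companion_vec` for $Y^T$ it is congruent to
$\operatorname{adj}(Y)_{ip}e_q$ modulo the image of `Y`, and $\operatorname{adj}(Y)_{ip}$ is the
trace. -/
theorem exists_mul_adjugate_eq_trace (Y H : Matrix (Fin n) (Fin n) S) :
    ∃ C, H * Y.adjugate =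
      (H * Y.adjugate).trace • (1 : Matrix (Fin n) (Fin n) S) + Y * C := by
  choose b hb using exists_companion_vec Y.transpose
  refine ⟨Matrix.of fun x q => ∑ p, ∑ i, H p i * b p q i x, ?_⟩
  ext a q
  have h1 : (Y * Matrix.of fun x q => ∑ p, ∑ i, H p i * b p q i x) a q =
      ∑ p, ∑ i, H p i * Y.mulVec (b p q i) a := by
    simp only [Matrix.mul_apply, Matrix.of_apply, Matrix.mulVec, dotProduct, Finset.mul_sum]
    rw [Finset.sum_comm]
    refine Finset.sum_congr rfl fun p _ => ?_
    rw [Finset.sum_comm]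
    exact Finset.sum_congr rfl fun p _ => Finset.sum_congr rfl fun x _ => by ring
  simp only [Matrix.transpose_transpose, ← Matrix.adjugate_transpose,
    Matrix.transpose_apply] at hb
  rw [Matrix.add_apply, h1]
  simp only [hb, Pi.sub_apply, Pi.single_apply, mul_sub, Finset.sum_sub_distrib]
  simp [Matrix.mul_apply, Matrix.trace, Matrix.one_apply]

theorem trace_mul_adjugate_mem (Y H : Matrix (Fin n) (Fin n) S) :
    (H * Y.adjugate).trace ∈ adjugateIdeal Y := by
  refine Ideal.sum_mem _ fun i _ => ?_
  rw [Matrix.diag_apply, Matrix.mul_apply]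
  exact Ideal.sum_mem _ fun j _ => Ideal.mul_mem_left _ _ (adjugate_mem_adjugateIdeal Y _ _)

theorem det_mem_adjugateIdeal (hn : 0 < n) (Y : Matrix (Fin n) (Fin n) S) :
    Y.det ∈ adjugateIdeal Y := by
  rw [Matrix.det_eq_sum_mul_adjugate_row Y ⟨0, hn⟩]
  exact Ideal.sum_mem _ fun _ _ => Ideal.mul_mem_left _ _ (adjugate_mem_adjugateIdeal Y _ _)

theorem exists_mul_adjugate_eq_smul_one_of_mem (Y : Matrix (Fin n) (Fin n) S) {s : S}
    (hs : s ∈ adjugateIdeal Y) :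
    ∃ H C, H * Y.adjugate = s • (1 : Matrix (Fin n) (Fin n) S) + Y * C := by
  suffices h : ∃ H, (H * Y.adjugate).trace = s by
    obtain ⟨H, rfl⟩ := h
    exact ⟨H, exists_mul_adjugate_eq_trace Y H⟩
  induction hs using Submodule.span_induction with
  | mem x hx =>
    obtain ⟨⟨i, j⟩, rfl⟩ := hx
    exact ⟨Matrix.single j i 1, by simp [Matrix.trace_single_mul]⟩
  | zero => exact ⟨0, by simp⟩
  | add x y _ _ hx hy =>
    obtain ⟨H, rfl⟩ := hx
    obtain ⟨H', rfl⟩ := hy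
    exact ⟨H + H', by rw [Matrix.add_mul, Matrix.trace_add]⟩
  | smul a x _ hx =>
    obtain ⟨H, rfl⟩ := hx
    exact ⟨a • H, by rw [Matrix.smul_mul, Matrix.trace_smul]⟩

theorem mul_left_cancel_of_det_ne_zero [IsDomain S] {Y M N : Matrix (Fin n) (Fin n) S}
    (hY : Y.det ≠ 0) (h : Y * M = Y * N) : M = N := by
  have h2 := congrArg (Y.adjugate * ·) h
  simp only [← Matrix.mul_assoc, Matrix.adjugate_mul, Matrix.smul_mul, Matrix.one_mul] at h2
  exact smul_right_injective _ hY h2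

theorem mul_right_cancel_of_det_ne_zero [IsDomain S] {Y M N : Matrix (Fin n) (Fin n) S}
    (hY : Y.det ≠ 0) (h : M * Y = N * Y) : M = N := by
  have h2 := congrArg (· * Y.adjugate) h
  simp only [Matrix.mul_assoc, Matrix.mul_adjugate, Matrix.mul_smul, Matrix.mul_one] at h2
  exact smul_right_injective _ hY h2

/-- With $t$ the trace of $H\operatorname{adj}(Y)$, the matrix $(s-t)\cdot 1$ is a multiple of `Y`.
Multiplying by the adjugate shows that $\det Y$ divides $(s-t)\operatorname{adj}(Y)$, so by `hdvd`
it divides $s-t$; both $t$ and $\det Y$ lie in the ideal. -/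
theorem mem_adjugateIdeal_of_mul_adjugate_eq [IsDomain S] (hn : 0 < n)
    {Y H C : Matrix (Fin n) (Fin n) S} {s : S}
    (hdvd : ∀ t, (∀ i j, Y.det ∣ t * Y.adjugate i j) → Y.det ∣ t)
    (h : H * Y.adjugate = s • (1 : Matrix (Fin n) (Fin n) S) + Y * C) :
    s ∈ adjugateIdeal Y := by
  obtain ⟨C', hC'⟩ := exists_mul_adjugate_eq_trace Y H
  set t := (H * Y.adjugate).trace with ht
  have h1 : (s - t) • (1 : Matrix (Fin n) (Fin n) S) = Y * (C' - C) := by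
    rw [Matrix.mul_sub, sub_smul, sub_eq_sub_iff_add_eq_add, ← h, add_comm, ← hC']
  have h2 : (s - t) • Y.adjugate = Y.det • (C' - C) := by
    have := congrArg (Y.adjugate * ·) h1
    simpa [← Matrix.mul_assoc, Matrix.adjugate_mul] using this
  have h3 : Y.det ∣ s - t := hdvd _ fun i j =>
    ⟨(C' - C) i j, by simpa using congrFun (congrFun h2 i) j⟩
  have h4 := Ideal.mem_of_dvd _ h3 (det_mem_adjugateIdeal hn Y)
  have := Ideal.add_mem _ h4 (trace_mul_adjugate_mem Y H)
  rwa [← ht, sub_add_cancel] at this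

end AdjugateIdeal

/-! ### Coprimality of the entries of the generic adjugate, and descent to $R$. -/

section GenericAdjugate

variable {K : Type u} [Field K] {n : ℕ}

theorem adjugate_genX_mem_supported (i j : Fin n) :
    (genX K n).adjugate j i ∈ MvPolynomial.supported K {v : Fin n × Fin n | v.1 ≠ i} := by
  rw [Matrix.adjugate_apply, Matrix.det_apply]
  refine Subalgebra.sum_mem _ fun σ _ => ?_
  rw [Units.smul_def]
  refine Subalgebra.zsmul_mem _ (Subalgebra.prod_mem _ fun a _ => ?_) _
  by_cases h : σ a = i
  · rw [h, Matrix.updateRow_self]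
    by_cases h' : a = j
    · subst h'
      simp
    · rw [Pi.single_eq_of_ne h']
      exact Subalgebra.zero_mem _
  · rw [Matrix.updateRow_ne h]
    exact MvPolynomial.X_mem_supported.2 h

theorem exists_adjugate_genX_ne_zero (i : Fin n) : ∃ j, (genX K n).adjugate j i ≠ 0 := by
  by_contra! h
  apply Matrix.det_mvPolynomialX_ne_zero (Fin n) K
  rw [Matrix.det_eq_sum_mul_adjugate_row _ i]
  exact Finset.sum_eq_zero fun j _ => by rw [h, mul_zero]

/-- For each row `i` some entry $\operatorname{adj}(X)_{ji}$ is nonzero, and it contains no variable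
of row `i`. Degrees add under multiplication, so a common divisor contains no variable at all and is
a nonzero constant. -/
theorem isUnit_of_forall_dvd_adjugate_genX (hn : 0 < n) {p : Poly K n}
    (hp : ∀ i j, p ∣ (genX K n).adjugate i j) : IsUnit p := by
  have hp0 : p ≠ 0 := by
    rintro rfl
    obtain ⟨j, hj⟩ := exists_adjugate_genX_ne_zero (K := K) (⟨0, hn⟩ : Fin n)
    exact hj (zero_dvd_iff.1 (hp _ _))
  have hdeg : ∀ v, p.degreeOf v = 0 := by
    rintro ⟨i, k⟩
    obtain ⟨j, hj⟩ := exists_adjugate_genX_ne_zero (K := K) i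
    obtain ⟨q, hq⟩ := hp j i
    have hq0 : q ≠ 0 := by
      rintro rfl
      exact hj (by rw [hq, mul_zero])
    have h0 : ((genX K n).adjugate j i).degreeOf (i, k) = 0 := by
      have := MvPolynomial.mem_supported.1 (adjugate_genX_mem_supported (K := K) i j)
      by_contra hv
      exact this (MvPolynomial.mem_vars_iff_degreeOf_ne_zero.2 hv) rfl
    rw [hq, MvPolynomial.degreeOf_mul_eq hp0 hq0] at h0
    lia
  have hbot : p ∈ MvPolynomial.supported K (∅ : Set (Fin n × Fin n)) :=
    MvPolynomial.mem_supported.2 fun v hv =>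
      (MvPolynomial.mem_vars_iff_degreeOf_ne_zero.1 hv (hdeg v)).elim
  rw [MvPolynomial.supported_empty, Algebra.mem_bot] at hbot
  obtain ⟨c, rfl⟩ := hbot
  exact (IsUnit.mk0 c (by rintro rfl; simp at hp0)).map _

theorem det_genX_dvd_of_forall_dvd_mul_adjugate (hn : 0 < n) (t : Poly K n)
    (h : ∀ i j, (genX K n).det ∣ t * (genX K n).adjugate i j) : (genX K n).det ∣ t := by
  classical
  let _ : StrongNormalizationMonoid (Poly K n) :=
    UniqueFactorizationMonoid.strongNormalizationMonoid
  let _ : NormalizedGCDMonoid (Poly K n) := UniqueFactorizationMonoid.toNormalizedGCDMonoid _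
  set g := (Finset.univ : Finset (Fin n × Fin n)).gcd fun p => (genX K n).adjugate p.1 p.2 with hg
  have hu : IsUnit g := isUnit_of_forall_dvd_adjugate_genX hn fun i j =>
    Finset.gcd_dvd (f := fun p : Fin n × Fin n => (genX K n).adjugate p.1 p.2)
      (Finset.mem_univ (i, j))
  have h1 : (genX K n).det ∣ (Finset.univ : Finset (Fin n × Fin n)).gcd
      fun p => t * (genX K n).adjugate p.1 p.2 := Finset.dvd_gcd fun p _ => h p.1 p.2
  exact hu.dvd_mul_right.1 (h1.trans (Finset.gcd_mul_left' _ _ t).dvd)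

theorem red_smul_one (s : Poly K n) :
    red (s • (1 : Matrix (Fin n) (Fin n) (Poly K n))) =
      (Ideal.Quotient.mk _ s : DetRing K n) • (1 : Matrix (Fin n) (Fin n) (DetRing K n)) := by
  ext i j
  by_cases hij : i = j <;> simp [red, hij]

theorem red_add (M N : Matrix (Fin n) (Fin n) (Poly K n)) : red (M + N) = red M + red N :=
  Matrix.map_add _ (map_add _) M N

theorem mem_adjugateIdeal_iff (hn : 0 < n) {Y : Matrix (Fin n) (Fin n) (Poly K n)}
    (hdet : Y.det = (genX K n).det)
    (hdvd : ∀ t, (∀ i j, Y.det ∣ t * Y.adjugate i j) → Y.det ∣ t) (s : Poly K n) :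
    s ∈ adjugateIdeal Y ↔ ∃ H C, H * red Y.adjugate =
      (Ideal.Quotient.mk _ s : DetRing K n) • (1 : Matrix (Fin n) (Fin n) (DetRing K n)) +
        red Y * C := by
  have red_surj : Function.Surjective (red (K := K) (n := n)) := fun M => by
    choose N hN using fun i j => Ideal.Quotient.mk_surjective (M i j)
    exact ⟨Matrix.of N, Matrix.ext hN⟩
  constructor
  · intro hs
    obtain ⟨H, C, h⟩ := exists_mul_adjugate_eq_smul_one_of_mem Y hs
    exact ⟨red H, red C, by rw [← red_mul, h, red_add, red_mul, red_smul_one]⟩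
  · rintro ⟨H', C', h⟩
    obtain ⟨H, rfl⟩ := red_surj H'
    obtain ⟨C, rfl⟩ := red_surj C'
    rw [← red_smul_one, ← red_mul, ← red_mul, ← red_add] at h
    have h1 : ∀ i j, ∃ c, (H * Y.adjugate) i j =
        (s • (1 : Matrix (Fin n) (Fin n) (Poly K n)) + Y * C) i j + Y.det * c := by
      intro i j
      have := congrFun (congrFun h i) j
      obtain ⟨c, hc⟩ := Ideal.mem_span_singleton.1 (Ideal.Quotient.eq.1 this)
      exact ⟨c, by rw [hdet, ← hc]; ring⟩
    choose c hc using h1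
    -- The error of lifting from $R$ to $S$ is a multiple of $\det Y$, hence of
    -- $Y\operatorname{adj}(Y)$, and is absorbed into the term `Y * C`.
    refine mem_adjugateIdeal_of_mul_adjugate_eq hn (H := H)
      (C := C + Y.adjugate * Matrix.of c) hdvd ?_
    rw [Matrix.mul_add, ← Matrix.mul_assoc, Matrix.mul_adjugate, ← add_assoc]
    ext i j
    rw [hc i j]
    simp

theorem mem_minorsIdeal_genX_iff (hn : 0 < n) (s : Poly K n) :
    s ∈ minorsIdeal (n - 1) (genX K n) ↔ ∃ H C, H * red (genX K n).adjugate =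
      (Ideal.Quotient.mk _ s : DetRing K n) • (1 : Matrix (Fin n) (Fin n) (DetRing K n)) +
        red (genX K n) * C := by
  rw [← mem_adjugateIdeal_iff hn rfl (det_genX_dvd_of_forall_dvd_mul_adjugate hn)]
  obtain ⟨m, rfl⟩ : ∃ m, n = m + 1 := ⟨n - 1, by lia⟩
  rw [← minorsIdeal_pred_eq_adjugateIdeal]
  rfl

theorem mem_minorsIdeal_genX_iff_transpose (hn : 0 < n) (s : Poly K n) :
    s ∈ minorsIdeal (n - 1) (genX K n) ↔ ∃ H C, H * red (genX K n).transpose.adjugate =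
      (Ideal.Quotient.mk _ s : DetRing K n) • (1 : Matrix (Fin n) (Fin n) (DetRing K n)) +
        red (genX K n).transpose * C := by
  rw [← mem_adjugateIdeal_iff hn (Matrix.det_transpose _) fun t ht => ?_]
  · obtain ⟨m, rfl⟩ : ∃ m, n = m + 1 := ⟨n - 1, by lia⟩
    rw [adjugateIdeal_transpose, ← minorsIdeal_pred_eq_adjugateIdeal]
    rfl
  · rw [Matrix.det_transpose]
    refine det_genX_dvd_of_forall_dvd_mul_adjugate hn t fun i j => ?_
    simpa [← Matrix.adjugate_transpose, Matrix.det_transpose] using ht j i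

end GenericAdjugate

/-! ### Annihilators of periodicity classes and Yoneda products via ladders. -/

section PeriodClass

variable {R : Type u} [CommRing R] {n : ℕ}

theorem cok_hom_ext {φ : Matrix (Fin n) (Fin n) R} {N : ModuleCat.{u} R} {f g : cok φ ⟶ N}
    (h : ∀ v : Fin n → R, f.hom (Submodule.Quotient.mk v) = g.hom (Submodule.Quotient.mk v)) :
    f = g := by
  ext x
  induction x using Submodule.Quotient.induction_on with
  | H v => exact h v

theorem cokMap_comp (φ₁ φ₂ φ₃ A B : Matrix (Fin n) (Fin n) R) (hA : ∃ C, A * φ₁ = φ₂ * C)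
    (hB : ∃ C, B * φ₂ = φ₃ * C) (hBA : ∃ C, B * A * φ₁ = φ₃ * C) :
    cokMap φ₁ φ₂ A hA ≫ cokMap φ₂ φ₃ B hB = cokMap φ₁ φ₃ (B * A) hBA := by
  refine cok_hom_ext fun v => ?_
  change Submodule.Quotient.mk (B.mulVec (A.mulVec v)) = Submodule.Quotient.mk ((B * A).mulVec v)
  rw [Matrix.mulVec_mulVec]

theorem cokMap_eq_smul_id {φ M C : Matrix (Fin n) (Fin n) R} {r : R}
    (hM : M = r • (1 : Matrix (Fin n) (Fin n) R) + φ * C) (h : ∃ B, M * φ = φ * B) :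
    cokMap φ φ M h = r • 𝟙 (cok φ) := by
  refine cok_hom_ext fun v => ?_
  change (Submodule.Quotient.mk (M.mulVec v) : (Fin n → R) ⧸ LinearMap.range φ.mulVecLin) =
    r • Submodule.Quotient.mk v
  rw [← Submodule.Quotient.mk_smul, Submodule.Quotient.eq]
  exact ⟨C.mulVec v, by simp [hM, Matrix.add_mulVec, Matrix.smul_mulVec, Matrix.mulVec_mulVec]⟩

/-- A commutative ladder between the sequences `0 → cok ψ → Rⁿ → cok φ → 0` and
`0 → cok ψ' → Rⁿ → cok φ' → 0` relates their extension classes. -/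
theorem syzClass_naturality {φ ψ φ' ψ' : Matrix (Fin n) (Fin n) R} (h : PeriodicPair φ ψ)
    (h' : PeriodicPair φ' ψ') {A B : Matrix (Fin n) (Fin n) R} (hAB : A * φ = φ' * B)
    (hB : ∃ C, B * ψ = ψ' * C) :
    (syzClass h).comp (Ext.mk₀ (cokMap ψ ψ' B hB)) (add_zero 1) =
      (Ext.mk₀ (cokMap φ φ' A ⟨B, hAB⟩)).comp (syzClass h') (zero_add 1) := by
  let F : syzSeq h ⟶ syzSeq h' :=
    { τ₁ := cokMap ψ ψ' B hB
      τ₂ := ModuleCat.ofHom A.mulVecLin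
      τ₃ := cokMap φ φ' A ⟨B, hAB⟩
      comm₁₂ := by
        refine cok_hom_ext fun v => ?_
        change φ'.mulVec (B.mulVec v) = A.mulVec (φ.mulVec v)
        rw [Matrix.mulVec_mulVec, Matrix.mulVec_mulVec, hAB]
      comm₂₃ := rfl }
  exact ShortComplex.ShortExact.extClass_naturality (syzSeq_shortExact h) (syzSeq_shortExact h') F

theorem smul_periodClass (s : R) {φ ψ : Matrix (Fin n) (Fin n) R} (h : PeriodicPair φ ψ) :
    s • periodClass h = (periodClass h).comp (Ext.mk₀ (s • 𝟙 (cok φ))) (add_zero 2) :=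
  Ext.smul_eq_comp_mk₀ _ _

theorem extClass_comp_mk₀_f_comp {T : ShortComplex (ModuleCat.{u} R)} (hT : T.ShortExact)
    {N : ModuleCat.{u} R} (g : T.X₂ ⟶ N) :
    hT.extClass.comp (Ext.mk₀ (T.f ≫ g)) (add_zero 1) = 0 := by
  rw [← Ext.mk₀_comp_mk₀]
  exact hT.extClass_comp_assoc _

/-- Dimension shifting: since $\operatorname{Ext}^1(R^n,-)=0$, composition with the first syzygy
class is injective on $\operatorname{Ext}^1$, and the pushout of the second sequence along
$s\cdot\mathrm{id}$ splits exactly when this map extends to $R^n$. -/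
theorem smul_periodClass_eq_zero_iff_exists_fac (s : R) {φ ψ : Matrix (Fin n) (Fin n) R}
    (h : PeriodicPair φ ψ) :
    s • periodClass h = 0 ↔
      ∃ g : (syzSeq h.symm).X₂ ⟶ cok φ, (syzSeq h.symm).f ≫ g = s • 𝟙 (cok φ) := by
  rw [smul_periodClass, periodClass,
    Ext.comp_assoc _ _ _ rfl (add_zero 1) (by norm_num : 1 + 1 + 0 = 2)]
  constructor
  · intro h0
    obtain ⟨x, hx⟩ := Ext.contravariant_sequence_exact₁ (syzSeq_shortExact h) (cok φ) _ rfl h0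
    have hx0 : x = 0 := Ext.eq_zero_of_projective (P := ModuleCat.of R (Fin n → R)) x
    rw [hx0, Ext.comp_zero] at hx
    obtain ⟨y, hy⟩ := Ext.contravariant_sequence_exact₁ (syzSeq_shortExact h.symm) (cok φ)
      (Ext.mk₀ (s • 𝟙 (cok φ))) rfl hx.symm
    obtain ⟨g, rfl⟩ := (Ext.mk₀_bijective _ _).2 y
    refine ⟨g, (Ext.mk₀_bijective _ _).1 ?_⟩
    rw [← hy, Ext.mk₀_comp_mk₀]
  · rintro ⟨g, hg⟩
    have : (syzClass h.symm).comp (Ext.mk₀ (s • 𝟙 (cok φ))) (add_zero 1) = 0 := by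
      rw [← hg]
      exact extClass_comp_mk₀_f_comp (syzSeq_shortExact h.symm) g
    rw [this, Ext.comp_zero]

/-- A map $R^n\to\operatorname{cok}\varphi$ lifts to a matrix `H`, and two matrices induce the same
map to $\operatorname{cok}\varphi$ when they differ by some $\varphi C$. -/
theorem smul_periodClass_eq_zero_iff (s : R) {φ ψ : Matrix (Fin n) (Fin n) R}
    (h : PeriodicPair φ ψ) :
    s • periodClass h = 0 ↔
      ∃ H C, H * ψ = s • (1 : Matrix (Fin n) (Fin n) R) + φ * C := by
  rw [smul_periodClass_eq_zero_iff_exists_fac]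
  constructor
  · rintro ⟨g, hg⟩
    choose H hH using fun i => Submodule.Quotient.mk_surjective _ (g.hom (Pi.single i 1))
    have hg' : ∀ v : Fin n → R, g.hom v = Submodule.Quotient.mk
        ((Matrix.of H).transpose.mulVec v) := by
      intro v
      have : g.hom = (LinearMap.range φ.mulVecLin).mkQ ∘ₗ
          (Matrix.of H).transpose.mulVecLin := by
        refine LinearMap.pi_ext' fun i => LinearMap.ext_ring ?_
        change g.hom (Pi.single i 1) = Submodule.Quotient.mk
          ((Matrix.of H).transpose.mulVec (Pi.single i 1))
        rw [← hH, Matrix.mulVec_single_one]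
        rfl
      rw [this]
      rfl
    have key : ∀ j, ∃ c, φ.mulVec c =
        (Matrix.of H).transpose.mulVec (ψ.mulVec (Pi.single j 1)) - s • Pi.single j 1 := by
      intro j
      have h1 := congrArg (fun f => f.hom (Submodule.Quotient.mk (Pi.single j 1))) hg
      have h2 : g.hom (ψ.mulVec (Pi.single j 1)) =
        (Submodule.Quotient.mk (s • Pi.single j 1) :
          (Fin n → R) ⧸ LinearMap.range φ.mulVecLin) := h1
      rw [hg'] at h2
      exact (Submodule.Quotient.eq _).1 h2
    choose c hc using key
    refine ⟨(Matrix.of H).transpose, (Matrix.of c).transpose, ?_⟩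
    ext i j
    have := congrFun (hc j) i
    rw [Matrix.mulVec_mulVec, Matrix.mulVec_single_one] at this
    have h3 : (φ * (Matrix.of c).transpose) i j = φ.mulVec (c j) i := rfl
    rw [Matrix.add_apply, h3, this]
    simp [Matrix.one_apply, Pi.single_apply]
  · rintro ⟨H, C, hHC⟩
    refine ⟨ModuleCat.ofHom ((LinearMap.range φ.mulVecLin).mkQ ∘ₗ H.mulVecLin), ?_⟩
    refine cok_hom_ext fun v => ?_
    change (Submodule.Quotient.mk (H.mulVec (ψ.mulVec v)) :
      (Fin n → R) ⧸ LinearMap.range φ.mulVecLin) = s • Submodule.Quotient.mk v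
    rw [← Submodule.Quotient.mk_smul, Submodule.Quotient.eq]
    exact ⟨C.mulVec v, by
      simp [Matrix.mulVec_mulVec, hHC, Matrix.add_mulVec, Matrix.smul_mulVec]⟩

/-- The identity identifies $\operatorname{cok}\psi$ with $\operatorname{cok}(-\psi)$ and matches
the first sequences. In the second sequences the inclusions differ by a sign, so the ladder has
$-\mathrm{id}$ on the left end. -/
theorem periodClass_neg_right {φ ψ : Matrix (Fin n) (Fin n) R} (h : PeriodicPair φ ψ) :
    periodClass h.neg_right = -periodClass h := by
  have e1 : (1 : Matrix (Fin n) (Fin n) R) * ψ = -ψ * -1 := by simp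
  have e2 : (-1 : Matrix (Fin n) (Fin n) R) * φ = φ * -1 := by simp
  have n1 := syzClass_naturality h h.neg_right (A := 1) (B := 1) (by simp) ⟨_, e1⟩
  have n2 := syzClass_naturality h.symm h.neg_right.symm (A := 1) (B := -1) e1 ⟨_, e2⟩
  have i1 : cokMap φ φ 1 ⟨1, by simp⟩ = 𝟙 (cok φ) := by
    rw [cokMap_eq_smul_id (r := 1) (C := 0) (by simp), one_smul]
  have i2 : cokMap φ φ (-1) ⟨_, e2⟩ = -𝟙 (cok φ) := by
    rw [cokMap_eq_smul_id (r := -1) (C := 0) (by simp), neg_one_smul]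
  rw [i1, Ext.mk₀_id_comp] at n1
  rw [i2, Ext.mk₀_neg, Ext.comp_neg, Ext.comp_mk₀_id] at n2
  rw [periodClass, periodClass, ← n1, Ext.comp_assoc_of_second_deg_zero, ← n2, Ext.comp_neg]

/-- The Yoneda product of two classes given by maps of first syzygies is a multiple of the
periodicity class. -/
theorem syzClass_comp_comp_syzClass_comp {φ ψ φ' ψ' : Matrix (Fin n) (Fin n) R}
    (h : PeriodicPair φ ψ) (h' : PeriodicPair φ' ψ') {A A' B C : Matrix (Fin n) (Fin n) R} {r : R}
    (hA : A * ψ = φ' * B) (hB : ∃ D, B * φ = ψ' * D) (hA' : ∃ D, A' * ψ' = φ * D)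
    (hr : A' * B = r • (1 : Matrix (Fin n) (Fin n) R) + φ * C) :
    ((syzClass h).comp (Ext.mk₀ (cokMap ψ φ' A ⟨B, hA⟩)) (add_zero 1)).comp
      ((syzClass h').comp (Ext.mk₀ (cokMap ψ' φ A' hA')) (add_zero 1)) rfl =
      r • periodClass h := by
  have hBA : ∃ D, A' * B * φ = φ * D := by
    obtain ⟨D, hD⟩ := hB
    obtain ⟨D', hD'⟩ := hA'
    exact ⟨D' * D, by rw [Matrix.mul_assoc, hD, ← Matrix.mul_assoc, hD', Matrix.mul_assoc]⟩
  -- Naturality moves the map induced by `A` past the second syzygy class, where it becomes the map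
  -- induced by `B`; what remains is the periodicity class followed by $A'B$.
  rw [Ext.comp_assoc_of_second_deg_zero, ← Ext.comp_assoc (Ext.mk₀ _) _ _ (zero_add 1) (add_zero 1)
    (by norm_num : 0 + 1 + 0 = 1),
    ← syzClass_naturality h.symm h' hA hB, Ext.comp_assoc_of_second_deg_zero, Ext.mk₀_comp_mk₀,
    cokMap_comp _ _ _ _ _ _ _ hBA, cokMap_eq_smul_id hr, smul_periodClass, periodClass,
    Ext.comp_assoc _ _ _ rfl (add_zero 1) (by norm_num : 1 + 1 + 0 = 2)]

end PeriodClass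

/-! ### Products of the classes represented by alternating matrices. -/

section AlternatingProducts

variable {K : Type u} [Field K] {n : ℕ} {A A' : Matrix (Fin n) (Fin n) (Poly K n)}

theorem exists_mul_adjugate_mul_eq_halfTrace (hA : IsAlternating A) (hA' : IsAlternating A') :
    ∃ C : Matrix (Fin n) (Fin n) (Poly K n), A * (genX K n).adjugate * A' =
      halfTrace A A' • (genX K n).transpose +
        (genX K n).transpose * C * (genX K n).transpose := by
  obtain ⟨C, hC⟩ := exists_alternating_mul_adjugate_mul (genX K n) hA hA'
  have hr : halfTrace A A' =
      -∑ p ∈ (Finset.univ : Finset (Fin n × Fin n)).filter (fun p => p.1 < p.2),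
        ∑ q ∈ (Finset.univ : Finset (Fin n × Fin n)).filter (fun q => q.1 < q.2),
          A p.1 p.2 * A' q.1 q.2 * twoRowMinor (genX K n) p.1 p.2 q.1 q.2 := by
    rw [halfTrace]
    refine congrArg Neg.neg
      (Finset.sum_congr rfl fun p hp => Finset.sum_congr rfl fun q hq => ?_)
    rw [twoRowMinor_eq_complMinor _ (Finset.mem_filter.1 hp).2 (Finset.mem_filter.1 hq).2]
    generalize complMinor (genX K n) _ _ = x
    generalize (-1 : Poly K n) ^ _ = y
    generalize A _ _ = a
    generalize A' _ _ = b
    ring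
  exact ⟨C, by rw [hr, hC]⟩

theorem det_transpose_genX_ne_zero : (genX K n).transpose.det ≠ 0 := by
  rw [Matrix.det_transpose]
  exact Matrix.det_mvPolynomialX_ne_zero (Fin n) K

/-- The companion `B` of a matrix `A` also satisfies `B X = adj(X)ᵀ A`. -/
theorem companion_mul_eq {Y B : Matrix (Fin n) (Fin n) (Poly K n)} (hY : Y.transpose.det ≠ 0)
    (hB : A * Y.adjugate = Y.transpose * B) : B * Y = Y.transpose.adjugate * A := by
  refine mul_left_cancel_of_det_ne_zero hY ?_
  rw [← Matrix.mul_assoc, ← hB, ← Matrix.mul_assoc, Matrix.mul_assoc, Matrix.adjugate_mul,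
    Matrix.mul_adjugate, Matrix.det_transpose, Matrix.mul_smul, Matrix.mul_one, Matrix.smul_mul,
    Matrix.one_mul]

/-- Transposing the companion equation gives $B^TY=-\operatorname{adj}(Y)^TA=-BY$, and `Y` cancels.
-/
theorem companion_transpose {Y B : Matrix (Fin n) (Fin n) (Poly K n)} (hA : IsAlternating A)
    (hY : Y.transpose.det ≠ 0) (hB : A * Y.adjugate = Y.transpose * B) : B.transpose = -B := by
  refine mul_right_cancel_of_det_ne_zero (Y := Y) (by rwa [Matrix.det_transpose] at hY) ?_
  have h := congrArg Matrix.transpose hB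
  rw [Matrix.transpose_mul, Matrix.transpose_mul, hA.1, Matrix.transpose_transpose,
    Matrix.adjugate_transpose] at h
  rw [← h, Matrix.neg_mul, companion_mul_eq hY hB, Matrix.mul_neg]

theorem red_eq_smul_one_add {M Y C : Matrix (Fin n) (Fin n) (Poly K n)} {r : Poly K n}
    (h : M = r • (1 : Matrix (Fin n) (Fin n) (Poly K n)) + Y * C) :
    red M = (Ideal.Quotient.mk _ r : DetRing K n) •
      (1 : Matrix (Fin n) (Fin n) (DetRing K n)) + red Y * red C := by
  rw [h, red_add, red_mul, red_smul_one]

theorem extOfAlt_comp_extOfAlt' (hA : IsAlternating A) (hA' : IsAlternating A') :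
    (extOfAlt A hA).comp (extOfAlt' A' hA') rfl =
      (Ideal.Quotient.mk _ (halfTrace A A') : DetRing K n) • thetaL K n := by
  obtain ⟨C, hC⟩ := exists_mul_adjugate_mul_eq_halfTrace hA hA'
  obtain ⟨B, hB⟩ := exists_companion (genX K n) A hA
  obtain ⟨B', hB'⟩ := exists_companion (genX K n).transpose A' hA'
  rw [Matrix.transpose_transpose] at hB'
  have hdet := det_transpose_genX_ne_zero (K := K) (n := n)
  have h1 : B * A' = halfTrace A A' • (1 : Matrix (Fin n) (Fin n) (Poly K n)) +
      C * (genX K n).transpose := by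
    refine mul_left_cancel_of_det_ne_zero hdet ?_
    rw [← Matrix.mul_assoc, ← hB, hC, Matrix.mul_add, Matrix.mul_smul, Matrix.mul_one,
      Matrix.mul_assoc]
  -- An endomorphism of $L$ needs the product in the order $A'B$, modulo $X$ on the left.
  -- Transposing `h1` provides this, the signs of the skew-symmetric `A'` and `B` cancelling.
  have h2 : A' * B = halfTrace A A' • (1 : Matrix (Fin n) (Fin n) (Poly K n)) +
      genX K n * C.transpose := by
    have := congrArg Matrix.transpose h1
    rwa [Matrix.transpose_mul, companion_transpose hA hdet hB, hA'.1, neg_mul_neg,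
      Matrix.transpose_add, Matrix.transpose_smul, Matrix.transpose_one, Matrix.transpose_mul,
      Matrix.transpose_transpose] at this
  exact syzClass_comp_comp_syzClass_comp (pairX K n) (pairXT K n) (A := red A) (A' := red A')
    (B := red B) (by rw [← red_mul, hB, red_mul])
    ⟨red A, by rw [← red_mul, companion_mul_eq hdet hB, red_mul]⟩
    ⟨red B', by rw [← red_mul, hB', red_mul]⟩ (by rw [← red_mul, red_eq_smul_one_add h2])

theorem extOfAlt'_comp_extOfAlt (hA : IsAlternating A) (hA' : IsAlternating A') :
    (extOfAlt' A' hA').comp (extOfAlt A hA) rfl =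
      (Ideal.Quotient.mk _ (halfTrace A A') : DetRing K n) • thetaLdual K n := by
  obtain ⟨C, hC⟩ := exists_mul_adjugate_mul_eq_halfTrace hA hA'
  obtain ⟨B, hB⟩ := exists_companion (genX K n) A hA
  obtain ⟨B', hB'⟩ := exists_companion (genX K n).transpose A' hA'
  have hdet := det_transpose_genX_ne_zero (K := K) (n := n)
  have h1 : B' * (genX K n).transpose = (genX K n).adjugate * A' := by
    rw [companion_mul_eq (by rwa [Matrix.det_transpose]) hB', Matrix.transpose_transpose]
  rw [Matrix.transpose_transpose] at hB'
  -- Here no transposition is needed: $B'X^T=\operatorname{adj}(X)A'$ turns the half-trace identity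
  -- into one with $X^T$ on the right throughout, and $X^T$ cancels.
  have h2 : A * B' = halfTrace A A' • (1 : Matrix (Fin n) (Fin n) (Poly K n)) +
      (genX K n).transpose * C := by
    refine mul_right_cancel_of_det_ne_zero hdet ?_
    rw [Matrix.mul_assoc, h1, ← Matrix.mul_assoc, hC, Matrix.add_mul, Matrix.smul_mul,
      Matrix.one_mul]
  exact syzClass_comp_comp_syzClass_comp (pairXT K n) (pairX K n) (A := red A') (A' := red A)
    (B := red B') (by rw [← red_mul, hB', red_mul]) ⟨red A', by rw [← red_mul, h1, red_mul]⟩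
    ⟨red B, by rw [← red_mul, hB, red_mul]⟩ (by rw [← red_mul, red_eq_smul_one_add h2])

end AlternatingProducts

/-! ### Passage to $S/I_{n-1}(X)$ and the theorem. -/

theorem exists_injective_quotient_addHom {S E : Type*} [CommRing S] [AddCommGroup E] (I : Ideal S)
    (f : S →+ E) (hf : ∀ s, f s = 0 ↔ s ∈ I) :
    ∃ Φ : S ⧸ I →+ E, Function.Injective Φ ∧ ∀ s, Φ (Ideal.Quotient.mk I s) = f s := by
  have hker : (Ideal.Quotient.mk I).toAddMonoidHom.ker ≤ f.ker := fun s hs =>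
    (hf s).2 (Ideal.Quotient.eq_zero_iff_mem.1 hs)
  let Φ : S ⧸ I →+ E := (Ideal.Quotient.mk I).toAddMonoidHom.liftOfSurjective
    Ideal.Quotient.mk_surjective ⟨f, hker⟩
  have hΦ : ∀ s, Φ (Ideal.Quotient.mk I s) = f s := fun s =>
    AddMonoidHom.liftOfRightInverse_comp_apply (Ideal.Quotient.mk I).toAddMonoidHom _
      (Function.rightInverse_surjInv Ideal.Quotient.mk_surjective) ⟨f, hker⟩ s
  refine ⟨Φ, (injective_iff_map_eq_zero Φ).2 fun x hx => ?_, hΦ⟩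
  obtain ⟨s, rfl⟩ := Ideal.Quotient.mk_surjective x
  rw [hΦ, hf] at hx
  exact Ideal.Quotient.eq_zero_iff_mem.2 hx

theorem exists_injective_smul {K : Type u} [Field K] {n : ℕ} {E : Type*} [AddCommGroup E]
    [Module (DetRing K n) E] (I : Ideal (Poly K n)) (θ : E)
    (h : ∀ s, (Ideal.Quotient.mk _ s : DetRing K n) • θ = 0 ↔ s ∈ I) :
    ∃ Φ : Poly K n ⧸ I →+ E, Function.Injective Φ ∧
      ∀ s, Φ (Ideal.Quotient.mk I s) = (Ideal.Quotient.mk _ s : DetRing K n) • θ :=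
  exists_injective_quotient_addHom I
    ((LinearMap.toSpanSingleton (DetRing K n) E θ).toAddMonoidHom.comp
      (Ideal.Quotient.mk (Ideal.span {(genX K n).det})).toAddMonoidHom) h

end DetExt

theorem mainTheorem11 (K : Type u) [Field K] (n : ℕ) (hn : 0 < n)
    (χ : Ext.{u} (DetExt.modL K n) (DetExt.modLdual K n) 1)
    (χ' : Ext.{u} (DetExt.modLdual K n) (DetExt.modL K n) 1)
    (A A' : Matrix (Fin n) (Fin n) (DetExt.Poly K n))
    (hA : DetExt.IsAlternating A) (hA' : DetExt.IsAlternating A')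
    (hχ : DetExt.extOfAlt A hA = χ) (hχ' : DetExt.extOfAlt' A' hA' = χ') :
    (∃ C : Matrix (Fin n) (Fin n) (DetExt.Poly K n),
      A * (DetExt.genX K n).adjugate * A' =
        DetExt.halfTrace A A' • (DetExt.genX K n).transpose +
          (DetExt.genX K n).transpose * C * (DetExt.genX K n).transpose) ∧
    (∃ Φ : (DetExt.Poly K n ⧸ DetExt.minorsIdeal (n - 1) (DetExt.genX K n)) →+
        Ext.{u} (DetExt.modL K n) (DetExt.modL K n) 2,
      Function.Injective Φ ∧
      (∀ s : DetExt.Poly K n, Φ (Ideal.Quotient.mk _ s) =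
        (Ideal.Quotient.mk _ s : DetExt.DetRing K n) • DetExt.thetaL K n) ∧
      Φ (Ideal.Quotient.mk _ (DetExt.halfTrace A A')) = χ.comp χ' rfl) ∧
    (∃ Φ : (DetExt.Poly K n ⧸ DetExt.minorsIdeal (n - 1) (DetExt.genX K n)) →+
        Ext.{u} (DetExt.modLdual K n) (DetExt.modLdual K n) 2,
      Function.Injective Φ ∧
      (∀ s : DetExt.Poly K n, Φ (Ideal.Quotient.mk _ s) =
        (Ideal.Quotient.mk _ s : DetExt.DetRing K n) • DetExt.thetaLdualSigned K n) ∧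
      Φ (Ideal.Quotient.mk _ (DetExt.halfTrace A A')) = -χ'.comp χ rfl) ∧
    (Ideal.Quotient.mk _ (DetExt.halfTrace A A') : DetExt.DetRing K n) •
      DetExt.thetaLdual K n = χ'.comp χ rfl := by
  subst hχ hχ'
  have hL : ∀ s, (Ideal.Quotient.mk _ s : DetExt.DetRing K n) • DetExt.thetaL K n = 0 ↔
      s ∈ DetExt.minorsIdeal (n - 1) (DetExt.genX K n) := fun s => by
    rw [DetExt.mem_minorsIdeal_genX_iff hn]
    exact DetExt.smul_periodClass_eq_zero_iff _ _
  -- Only this sign separates the two assertions about $\chi\chi'$; it does not affect the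
  -- annihilator.
  have hsign : DetExt.thetaLdualSigned K n = -DetExt.thetaLdual K n :=
    DetExt.periodClass_neg_right _
  have hLdual : ∀ s,
      (Ideal.Quotient.mk _ s : DetExt.DetRing K n) • DetExt.thetaLdualSigned K n = 0 ↔
        s ∈ DetExt.minorsIdeal (n - 1) (DetExt.genX K n) := fun s => by
    rw [DetExt.mem_minorsIdeal_genX_iff_transpose hn, hsign, smul_neg, neg_eq_zero]
    exact DetExt.smul_periodClass_eq_zero_iff _ _
  refine ⟨DetExt.exists_mul_adjugate_mul_eq_halfTrace hA hA', ?_, ?_,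
    (DetExt.extOfAlt'_comp_extOfAlt hA hA').symm⟩
  · obtain ⟨Φ, hinj, hΦ⟩ := DetExt.exists_injective_smul _ _ hL
    exact ⟨Φ, hinj, hΦ, (hΦ _).trans (DetExt.extOfAlt_comp_extOfAlt' hA hA').symm⟩
  · obtain ⟨Φ, hinj, hΦ⟩ := DetExt.exists_injective_smul _ _ hLdual
    refine ⟨Φ, hinj, hΦ, ?_⟩
    rw [hΦ, hsign, smul_neg, DetExt.extOfAlt'_comp_extOfAlt hA hA']
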